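/- Let $\gamma=(1+\sqrt5)/2$. For $\xi\in\mathbb R$ and $\mathbf x=(x_0,x_1,x_2)\in\mathbb Z^3$ put $\|\mathbf x\|=\max\{|x_0|,|x_1|,|x_2|\}$, $L_\xi(\mathbf x)=\max\{|x_0\xi-x_1|,|x_0\xi^2-x_2|\}$ and $\det(\mathbf x)=x_0x_2-x_1^2$; for $x\in\mathbb R$ let $\{x\}=\min_{p\in\mathbb Z}|x-p|$ denote the distance from $x$ to a nearest integer. The height $H(\alpha)$ of an algebraic number $\alpha$ is the maximum of the absolute values of the coefficients of its irreducible polynomial over $\mathbb Z$. A real number $\xi$ is called extremal if it is neither rational nor quadratic irrational and there is a constant $c>0$ such that, for every real $X\ge1$, the inequalities $|x_0|\le X$, $|x_0\xi-x_1|\le cX^{-1/\gamma}$, $|x_0\xi^2-x_2|\le cX^{-1/\gamma}$ have a non-zero solution $(x_0,x_1,x_2)\in\mathbb Z^3$. Let $\xi$ be an extremal real number, let $(Y_k)_{k\ge1}$ be a strictly increasing sequence of positive integers, and let $(\mathbf y_k)_{k\ge1}$, $\mathbf y_k=(y_{k,0},y_{k,1},y_{k,2})$, be a sequence of points of $\mathbb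 Z^3$ such that, for all $k\ge1$, $$Y_{k+1}\sim Y_k^{\gamma},\qquad \|\mathbf y_k\|\sim Y_k,\qquad L_\xi(\mathbf y_k)\sim Y_k^{-1},$$ $$1\le|\det(\mathbf y_k)|\ll1,\qquad 1\le|\det(\mathbf y_k,\mathbf y_{k+1},\mathbf y_{k+2})|\ll1,$$ where $A\ll B$ means $A\le cB$ for a constant $c>0$ independent of $k$, and $A\sim B$ means $A\ll B\ll A$. **Proposition 10.1.** Let $\ell$ be the least common multiple of all the integers $d_k=\det(\mathbf y_k,\mathbf y_{k+1},\mathbf y_{k+2})$, $k\ge1$. Assume that, for some real numbers $c_1>0$ and $\delta>0$, there are infinitely many indices $k\ge1$ with $$\Big\{\frac{y_{k,0}\,\xi^3}{\ell}\Big\}\le c_1Y_k^{-\delta}.$$ Then there exist a constant $c_2>0$ and infinitely many algebraic integers $\alpha\in\mathbb C$ of degree $\le3$ such that $$|\xi-\alpha|\le c_2H(\alpha)^{-\theta},\qquad \theta=\frac{\gamma^2-\delta}{1-\delta}.$$ (The assumption cannot hold with $\delta\ge1$, so $\theta$ is well defined.) -/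

import Mathlib

namespace CubicApprox

/-- The golden ratio `γ = (1 + √5) / 2`. -/
local notation "γ" => Real.goldenRatio

/-- `L_ξ(x) = max {|x₀ ξ - x₁|, |x₀ ξ² - x₂|}` for an integral point `x = (x₀, x₁, x₂)`. -/
noncomputable def L (ξ : ℝ) (x : Fin 3 → ℤ) : ℝ :=
  max |(x 0 : ℝ) * ξ - (x 1 : ℝ)| |(x 0 : ℝ) * ξ ^ 2 - (x 2 : ℝ)|

/-- `max {|x₀|, |x₁|, |x₂|}`, as a real number. -/
noncomputable def maxNorm (x : Fin 3 → ℤ) : ℝ :=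
  max |(x 0 : ℝ)| (max |(x 1 : ℝ)| |(x 2 : ℝ)|)

/-- The determinant of the symmetric matrix with rows `(x₀, x₁)`, `(x₁, x₂)`. -/
def symDet (x : Fin 3 → ℤ) : ℤ := (!![x 0, x 1; x 1, x 2]).det

/-- The determinant of the matrix with rows `x`, `y`, `z`. -/
def det3 (x y z : Fin 3 → ℤ) : ℤ := (Matrix.of ![x, y, z]).det

/-- A real number is extremal if it is neither rational nor quadratic irrational and if, for some
constant `c > 0`, the system `|x₀| ≤ X`, `|x₀ ξ - x₁| ≤ c X ^ (-1/γ)`,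
`|x₀ ξ² - x₂| ≤ c X ^ (-1/γ)` has a nonzero integral solution for every real `X ≥ 1`. -/
def IsExtremal (ξ : ℝ) : Prop :=
  Irrational ξ ∧
  ¬ (IsAlgebraic ℚ ξ ∧ (minpoly ℚ ξ).natDegree = 2) ∧
  ∃ c : ℝ, 0 < c ∧ ∀ X : ℝ, 1 ≤ X → ∃ x : Fin 3 → ℤ, x ≠ 0 ∧
    |(x 0 : ℝ)| ≤ X ∧
    |(x 0 : ℝ) * ξ - (x 1 : ℝ)| ≤ c * X ^ (-(1 / γ)) ∧
    |(x 0 : ℝ) * ξ ^ 2 - (x 2 : ℝ)| ≤ c * X ^ (-(1 / γ))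

/-- `a k ≪ b k` for `k ≥ 1`: there is a constant `c > 0`, independent of `k`, with
`a k ≤ c * b k` for all `k ≥ 1`. -/
def Dominated (a b : ℕ → ℝ) : Prop := ∃ c : ℝ, 0 < c ∧ ∀ k : ℕ, 1 ≤ k → a k ≤ c * b k

/-- `a k ∼ b k` for `k ≥ 1`: both `a ≪ b` and `b ≪ a`. -/
def Comparable (a b : ℕ → ℝ) : Prop := Dominated a b ∧ Dominated b a

/-- The sequences `(Y_k)_{k ≥ 1}` of positive integers and `(y_k)_{k ≥ 1}` of points of `ℤ³` form an
approximating pair for `ξ`. Only the terms of index `k ≥ 1` matter. -/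
structure IsApproxPair (ξ : ℝ) (Y : ℕ → ℕ) (y : ℕ → Fin 3 → ℤ) : Prop where
  pos : ∀ k, 1 ≤ k → 0 < Y k
  increasing : ∀ k, 1 ≤ k → Y k < Y (k + 1)
  growth : Comparable (fun k => (Y (k + 1) : ℝ)) (fun k => (Y k : ℝ) ^ γ)
  norm : Comparable (fun k => maxNorm (y k)) (fun k => (Y k : ℝ))
  approx : Comparable (fun k => L ξ (y k)) (fun k => ((Y k : ℝ))⁻¹)
  one_le_symDet : ∀ k, 1 ≤ k → 1 ≤ |symDet (y k)|
  symDet_bounded : Dominated (fun k => (|symDet (y k)| : ℤ)) (fun _ => 1)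
  one_le_det3 : ∀ k, 1 ≤ k → 1 ≤ |det3 (y k) (y (k + 1)) (y (k + 2))|
  det3_bounded : Dominated (fun k => (|det3 (y k) (y (k + 1)) (y (k + 2))| : ℤ)) (fun _ => 1)

/-- The least common multiple of the integers `d k`, `k ≥ 1`: the least positive integer divisible
by all of them (with value `0` if there is none). -/
noncomputable def seqLcm (d : ℕ → ℤ) : ℕ :=
  sInf {m : ℕ | 0 < m ∧ ∀ k : ℕ, 1 ≤ k → d k ∣ (m : ℤ)}

/-- The distance from `x` to a nearest integer (`round_le` shows that it is
the minimum of `|x - p|` over all integers `p`). -/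
noncomputable def distInt (x : ℝ) : ℝ := |x - (round x : ℝ)|

/-- The height of an algebraic integer `α`: the maximum of the absolute values of the coefficients
of its irreducible polynomial over `ℤ`, which for an algebraic integer is `minpoly ℤ α`. -/
noncomputable def height (α : ℂ) : ℝ := (minpoly ℤ α).supNorm

end CubicApprox

/-!
The algebraic integers are roots of monic cubics `P = T³ - c₂ T² - c₁ T - c₀` found by
interpolation. Write `γ` for the golden ratio and `x, z, w` for `y_k, y_{k+1}, y_{k+2}`, where the
*middle* point `z` is one for which `z₀ ξ³ / ℓ` is close to an integer. Choose integers `m₀, m₁, m₂`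
such that the errors `e₀ = ℓ m₀ - x₀ ξ³`, `e₁ = ℓ m₁ - z₀ ξ³`, `e₂ = ℓ m₂ - w₀ ξ³` are bounded, with
`m₁` the best choice, so that `|e₁| ≪ Y_{k+1} ^ (-δ)`. Because `det(x, z, w)` divides `ℓ`, there is an
integral linear form `c` with the values `ℓ m₀, ℓ m₁, ℓ m₂` at `x, z, w`
(`CubicApprox.exists_interpolation`). The form `c - (ξ³, 0, 0)` is bounded at `w`, which is nearly
proportional to `(1, ξ, ξ²)`, whence `|P(ξ)| ≪ 1 / Y_{k+2}`. By Cramer's rule and the estimate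
`y_i × y_j = O(Y_j / Y_i)` for `i < j`, the coefficients are `O(h)` with
`h = Y_{k+2} / Y_{k+1} + |e₁| Y_{k+2} / Y_k`.

The derivative `P'(ξ)` has exact order `h`. Indeed `symDet (y_i) ≠ 0` bounds
`y_{i,2} - 2 ξ y_{i,1} + ξ² y_{i,0}` from below, so that the combination `v₁ + 2 ξ v₂` of the
coordinates of `v = y_i × y_j` is not smaller than `v` itself
(`CubicApprox.IsApproxPair.cross_tangent_isTheta`), and the sign of `e₀`, which is free, is chosen so
that the two leading terms do not cancel (`CubicApprox.CubicFamily.size_isBigO_tangent`). The root of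
`P` nearest to `ξ` then satisfies `|ξ - α| ≤ 3 |P(ξ)| / |P'(ξ)| ≪ Y_{k+1} ^ (-γ) / h`, and its height
is `O(h)` by a Mahler measure argument. When `δ ≤ 2 - γ` we have `h ≪ Y_{k+1} ^ (1 - δ)`, and the
claim follows (`CubicApprox.CubicFamily.exists_infinite`).

When `δ > 2 - γ`, which includes all `δ ≥ 1`, there are no such `z`: this repulsion property is
`CubicApprox.IsApproxPair.not_isBigO_rpow`.
-/

namespace CubicApprox

/-! ### Roots of monic integral cubics -/

section Roots

open Polynomial

/-- With `A` and `D` the values at `x` of a monic cubic and of its derivative, the root `α` nearest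
to `x` satisfies `|x - α| |D| ≤ 3 |A|`, because `D / A` is the sum of the three `1 / (x - root)`. -/
theorem exists_near_root_of_factor {x a b c A D : ℂ}
    (hA : A = (x - a) * (x - b) * (x - c))
    (hD : D = (x - b) * (x - c) + (x - a) * (x - c) + (x - a) * (x - b)) :
    ∃ α, (α = a ∨ α = b ∨ α = c) ∧ ‖x - α‖ * ‖D‖ ≤ 3 * ‖A‖ := by
  obtain ⟨α, hα, ha, hb, hc⟩ : ∃ α, (α = a ∨ α = b ∨ α = c) ∧
      ‖x - α‖ ≤ ‖x - a‖ ∧ ‖x - α‖ ≤ ‖x - b‖ ∧ ‖x - α‖ ≤ ‖x - c‖ := by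
    rcases le_total ‖x - a‖ ‖x - b‖ with h1 | h1 <;>
    rcases le_total ‖x - b‖ ‖x - c‖ with h2 | h2 <;>
    rcases le_total ‖x - a‖ ‖x - c‖ with h3 | h3
    all_goals first
      | exact ⟨a, .inl rfl, le_rfl, by linarith, by linarith⟩
      | exact ⟨b, .inr (.inl rfl), by linarith, le_rfl, by linarith⟩
      | exact ⟨c, .inr (.inr rfl), by linarith, by linarith, le_rfl⟩
  refine ⟨α, hα, ?_⟩
  have hD' : ‖D‖ ≤ ‖x - b‖ * ‖x - c‖ + ‖x - a‖ * ‖x - c‖ + ‖x - a‖ * ‖x - b‖ := by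
    rw [hD]
    refine (norm_add₃_le).trans ?_
    simp only [norm_mul, le_refl]
  rw [hA, norm_mul, norm_mul]
  calc ‖x - α‖ * ‖D‖
      ≤ ‖x - α‖ * (‖x - b‖ * ‖x - c‖ + ‖x - a‖ * ‖x - c‖ + ‖x - a‖ * ‖x - b‖) := by gcongr
    _ = ‖x - α‖ * (‖x - b‖ * ‖x - c‖) + ‖x - α‖ * (‖x - a‖ * ‖x - c‖)
          + ‖x - α‖ * (‖x - a‖ * ‖x - b‖) := by ring
    _ ≤ ‖x - a‖ * (‖x - b‖ * ‖x - c‖) + ‖x - b‖ * (‖x - a‖ * ‖x - c‖)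
          + ‖x - c‖ * (‖x - a‖ * ‖x - b‖) := by gcongr
    _ = 3 * (‖x - a‖ * ‖x - b‖ * ‖x - c‖) := by ring

theorem one_le_height {α : ℂ} (hα : IsIntegral ℤ α) : 1 ≤ height α := by
  have h := (minpoly ℤ α).le_supNorm (minpoly ℤ α).natDegree
  rw [coeff_natDegree, minpoly.monic hα] at h
  simpa [height] using h

/-- The minimal polynomial of `α` is a factor of `P` whose cofactor is monic, hence of Mahler
measure at least `1`; so its coefficients are bounded by the Mahler measure of `P`. -/
theorem height_le_of_dvd {α : ℂ} (hα : IsIntegral ℤ α) {P : ℤ[X]} (hP : P.Monic)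
    (hdvd : minpoly ℤ α ∣ P) (hdeg : P.natDegree ≤ 3) {H : ℝ} (hH : ∀ i, |(P.coeff i : ℝ)| ≤ H) :
    height α ≤ 6 * H := by
  obtain ⟨Q, hQ⟩ := hdvd
  have hQm : Q.Monic := by
    refine (minpoly.monic hα).of_mul_monic_left ?_
    rw [← hQ]; exact hP
  set g := (minpoly ℤ α).map (Int.castRingHom ℂ) with hg
  set h := Q.map (Int.castRingHom ℂ) with hh
  have hgh : P.map (Int.castRingHom ℂ) = g * h := by rw [hQ, Polynomial.map_mul]
  have hM : 1 ≤ h.mahlerMeasure := by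
    apply one_le_mahlerMeasure_of_one_le_norm_leadingCoeff
    simp [(hQm.map (Int.castRingHom ℂ)).leadingCoeff, hh]
  have hMP : (g * h).mahlerMeasure ≤ 2 * H := by
    rw [← hgh]
    refine (mahlerMeasure_le_sqrt_natDegree_add_one_mul_supNorm _).trans ?_
    have h1 : (P.map (Int.castRingHom ℂ)).supNorm ≤ H := by
      obtain ⟨i, hi⟩ := exists_eq_supNorm (P.map (Int.castRingHom ℂ))
      rw [hi]
      simpa using hH i
    have h2 : √(((P.map (Int.castRingHom ℂ)).natDegree : ℝ) + 1) ≤ 2 := by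
      rw [Real.sqrt_le_left (by norm_num)]
      have : ((P.map (Int.castRingHom ℂ)).natDegree : ℝ) ≤ 3 := by
        exact_mod_cast (natDegree_map_le).trans hdeg
      linarith
    gcongr
    exact supNorm_nonneg _
  have hgdeg : g.natDegree ≤ 3 := by
    refine natDegree_map_le.trans (le_trans ?_ hdeg)
    rw [hQ, (minpoly.monic hα).natDegree_mul hQm]
    omega
  obtain ⟨i, hi⟩ := exists_eq_supNorm (minpoly ℤ α)
  have key := norm_coeff_le_choose_mul_mahlerMeasure_of_one_le_mahlerMeasure i g h hM
  have hch : (g.natDegree.choose i : ℝ) ≤ 3 := by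
    have : g.natDegree.choose i ≤ 3 := by
      refine (Nat.choose_le_choose i hgdeg).trans ?_
      rcases Nat.lt_or_ge 3 i with h | h
      · simp [Nat.choose_eq_zero_of_lt h]
      · interval_cases i <;> decide
    exact_mod_cast this
  have hci : ‖(minpoly ℤ α).coeff i‖ = ‖g.coeff i‖ := by simp [hg, Int.norm_eq_abs]
  have h0 : 0 ≤ (g * h).mahlerMeasure := mahlerMeasure_nonneg _
  calc height α = ‖g.coeff i‖ := by rw [height, hi, hci]
    _ ≤ _ := key
    _ ≤ 3 * (2 * H) := by gcongr
    _ = 6 * H := by ring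

/-- The monic cubic `T³ - p T² - q T - r` has a root `α` close to `ξ`, whose height is bounded by
the size of `r`, `q` and `p`. -/
theorem exists_near_root (ξ : ℝ) (r q p : ℤ) {H : ℝ} (hH : 1 ≤ H) (hr : |(r : ℝ)| ≤ H)
    (hq : |(q : ℝ)| ≤ H) (hp : |(p : ℝ)| ≤ H) :
    ∃ α : ℂ, α ^ 3 = p * α ^ 2 + q * α + r ∧ IsIntegral ℤ α ∧ (minpoly ℤ α).natDegree ≤ 3 ∧
      ‖(ξ : ℂ) - α‖ * |3 * ξ ^ 2 - (q + 2 * ξ * p)| ≤ 3 * |ξ ^ 3 - (p * ξ ^ 2 + q * ξ + r)| ∧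
      height α ≤ 6 * H := by
  let c : Cubic ℤ := ⟨1, -p, -q, -r⟩
  let cC : Cubic ℂ := ⟨1, -p, -q, -r⟩
  have ha : cC.a ≠ 0 := one_ne_zero
  obtain ⟨x, y, z, hxyz⟩ := (Cubic.splits_iff_roots_eq_three (φ := RingHom.id ℂ) ha).1
    (IsAlgClosed.splits _)
  have e1 := Cubic.b_eq_three_roots ha hxyz
  have e2 := Cubic.c_eq_three_roots ha hxyz
  have e3 := Cubic.d_eq_three_roots ha hxyz
  simp only [cC, RingHom.id_apply, one_mul] at e1 e2 e3
  have hA : (ξ : ℂ) ^ 3 - (p * ξ ^ 2 + q * ξ + r) = (ξ - x) * (ξ - y) * (ξ - z) := by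
    linear_combination (ξ : ℂ) ^ 2 * e1 + ξ * e2 + e3
  have hD : 3 * (ξ : ℂ) ^ 2 - (q + 2 * ξ * p)
      = (ξ - y) * (ξ - z) + (ξ - x) * (ξ - z) + (ξ - x) * (ξ - y) := by
    linear_combination 2 * (ξ : ℂ) * e1 + e2
  obtain ⟨α, hα, hle⟩ := exists_near_root_of_factor hA hD
  have hroot : α ^ 3 = p * α ^ 2 + q * α + r := by
    have : (α - x) * (α - y) * (α - z) = 0 := by rcases hα with h | h | h <;> simp [h]
    linear_combination this + (α : ℂ) ^ 2 * e1 + α * e2 + e3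
  have hmon : c.toPoly.Monic := Cubic.monic_of_a_eq_one rfl
  have hev : aeval α c.toPoly = 0 := by
    simp [c, Cubic.toPoly]
    linear_combination hroot
  have hint : IsIntegral ℤ α := ⟨c.toPoly, hmon, by simpa [aeval_def] using hev⟩
  have hdvd := minpoly.isIntegrallyClosed_dvd hint hev
  have hdeg : c.toPoly.natDegree = 3 := Cubic.natDegree_of_a_ne_zero one_ne_zero
  refine ⟨α, hroot, hint, ?_, ?_, ?_⟩
  · rw [← hdeg]; exact natDegree_le_of_dvd hdvd hmon.ne_zero
  · convert hle using 2
    · rw [← Real.norm_eq_abs, ← Complex.norm_real]; push_cast; rfl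
    · rw [← Real.norm_eq_abs, ← Complex.norm_real]; push_cast; rfl
  · refine height_le_of_dvd hint hmon hdvd hdeg.le fun i => ?_
    rcases Nat.lt_or_ge 3 i with h | h
    · rw [Cubic.coeff_eq_zero h]; simp; linarith
    · interval_cases i
      · simpa [c] using hr
      · simpa [c] using hq
      · simpa [c] using hp
      · simpa [c] using hH

end Roots

open Asymptotics Filter Topology
open scoped Matrix

/-! ### The errors of an approximating point -/

/-- The signed error `x₁ - ξ x₀`. -/
def linErr (ξ : ℝ) (x : Fin 3 → ℤ) : ℝ := x 1 - ξ * x 0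

/-- The signed error `x₂ - ξ² x₀`. -/
def sqErr (ξ : ℝ) (x : Fin 3 → ℤ) : ℝ := x 2 - ξ ^ 2 * x 0

/-- The combination `x₂ - 2 ξ x₁ + ξ² x₀`. It is the part of the error that `symDet` controls from
below: see `symDet_eq`. -/
def tanErr (ξ : ℝ) (x : Fin 3 → ℤ) : ℝ := sqErr ξ x - 2 * ξ * linErr ξ x

/-- The value `v₁ + 2 ξ v₂` at `ξ` of the derivative of `v₀ + v₁ T + v₂ T²`. -/
def tangent (ξ : ℝ) (v : Fin 3 → ℤ) : ℝ := v 1 + 2 * ξ * v 2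

theorem symDet_eq (ξ : ℝ) (x : Fin 3 → ℤ) :
    (symDet x : ℝ) = x 0 * tanErr ξ x - linErr ξ x ^ 2 := by
  simp only [symDet, Matrix.det_fin_two_of, tanErr, linErr, sqErr]
  push_cast
  ring

theorem tangent_cross (ξ : ℝ) (u v : Fin 3 → ℤ) :
    tangent ξ (u ⨯₃ v) = v 0 * tanErr ξ u - u 0 * tanErr ξ v := by
  simp only [tangent, cross_apply, tanErr, linErr, sqErr, Matrix.cons_val]
  push_cast
  ring

theorem Dominated.isBigO {a b : ℕ → ℝ} (h : Dominated a b) (ha : ∀ k, 0 ≤ a k) :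
    a =O[atTop] b := by
  obtain ⟨c, hc0, hc⟩ := h
  refine IsBigO.of_bound c ?_
  filter_upwards [eventually_ge_atTop 1] with k hk
  rw [Real.norm_of_nonneg (ha k)]
  exact (hc k hk).trans (mul_le_mul_of_nonneg_left (le_abs_self _) hc0.le)

theorem cross_zero_eq (ξ : ℝ) (u v : Fin 3 → ℤ) :
    ((u ⨯₃ v) 0 : ℝ) = v 0 * (ξ ^ 2 * linErr ξ u - ξ * sqErr ξ u)
      + (u 0 * (ξ * sqErr ξ v - ξ ^ 2 * linErr ξ v)
        + (linErr ξ u * sqErr ξ v - sqErr ξ u * linErr ξ v)) := by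
  simp only [cross_apply, linErr, sqErr, Matrix.cons_val]
  push_cast
  ring

theorem cross_one_eq (ξ : ℝ) (u v : Fin 3 → ℤ) :
    ((u ⨯₃ v) 1 : ℝ) = v 0 * sqErr ξ u - u 0 * sqErr ξ v := by
  simp only [cross_apply, sqErr, Matrix.cons_val]
  push_cast
  ring

theorem cross_two_eq (ξ : ℝ) (u v : Fin 3 → ℤ) :
    ((u ⨯₃ v) 2 : ℝ) = u 0 * linErr ξ v - v 0 * linErr ξ u := by
  simp only [cross_apply, linErr, Matrix.cons_val]
  push_cast
  ring

namespace IsApproxPair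

variable {ξ : ℝ} {Y : ℕ → ℕ} {y : ℕ → Fin 3 → ℤ}

theorem tendsto (hy : IsApproxPair ξ Y y) : Tendsto (fun k => (Y k : ℝ)) atTop atTop := by
  refine tendsto_natCast_atTop_atTop.comp ?_
  rw [← tendsto_add_atTop_iff_nat 1]
  refine (strictMono_nat_of_lt_succ fun k => ?_).tendsto_atTop
  exact hy.increasing (k + 1) (by omega)

theorem le_of_le (hy : IsApproxPair ξ Y y) {i j : ℕ} (hi : 1 ≤ i) (hij : i ≤ j) : Y i ≤ Y j := by
  induction j, hij using Nat.le_induction with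
  | base => exact le_rfl
  | succ n hn ih => exact ih.trans (hy.increasing n (hi.trans hn)).le

theorem eventually_pos (hy : IsApproxPair ξ Y y) (i : ℕ) :
    ∀ᶠ k in atTop, 0 < (Y (k + i) : ℝ) :=
  ((tendsto_add_atTop_iff_nat i).2 hy.tendsto).eventually_gt_atTop 0

theorem succ_isTheta (hy : IsApproxPair ξ Y y) :
    (fun k => (Y (k + 1) : ℝ)) =Θ[atTop] fun k => (Y k : ℝ) ^ Real.goldenRatio :=
  ⟨hy.growth.1.isBigO fun _ => by positivity, hy.growth.2.isBigO fun _ => by positivity⟩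

theorem linErr_isBigO (hy : IsApproxPair ξ Y y) :
    (fun k => linErr ξ (y k)) =O[atTop] fun k => (Y k : ℝ)⁻¹ := by
  refine IsBigO.trans (IsBigO.of_norm_le fun k => ?_)
    (hy.approx.1.isBigO fun _ => by unfold L; positivity)
  rw [Real.norm_eq_abs, linErr, abs_sub_comm, mul_comm]
  exact le_max_left _ _

theorem sqErr_isBigO (hy : IsApproxPair ξ Y y) :
    (fun k => sqErr ξ (y k)) =O[atTop] fun k => (Y k : ℝ)⁻¹ := by
  refine IsBigO.trans (IsBigO.of_norm_le fun k => ?_)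
    (hy.approx.1.isBigO fun _ => by unfold L; positivity)
  rw [Real.norm_eq_abs, sqErr, abs_sub_comm, mul_comm]
  exact le_max_right _ _

theorem tanErr_isBigO (hy : IsApproxPair ξ Y y) :
    (fun k => tanErr ξ (y k)) =O[atTop] fun k => (Y k : ℝ)⁻¹ :=
  hy.sqErr_isBigO.sub (hy.linErr_isBigO.const_mul_left _)

theorem inv_isLittleO (hy : IsApproxPair ξ Y y) :
    (fun k => (Y k : ℝ)⁻¹) =o[atTop] fun k => (Y k : ℝ) :=
  (tendsto_inv_atTop_zero.comp hy.tendsto).isBigO_one ℝ |>.trans_isLittleO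
    (isLittleO_const_left.2 (Or.inr (tendsto_norm_atTop_atTop.comp hy.tendsto)))

theorem zero_isTheta (hy : IsApproxPair ξ Y y) :
    (fun k => (y k 0 : ℝ)) =Θ[atTop] fun k => (Y k : ℝ) := by
  have h0 : ∀ k, 0 ≤ maxNorm (y k) := fun k => by unfold maxNorm; positivity
  constructor
  · refine IsBigO.trans (IsBigO.of_norm_le fun k => ?_) (hy.norm.1.isBigO h0)
    exact le_max_left _ _
  · -- the other two coordinates are `ξ y₀` and `ξ² y₀` up to a negligible error
    have h1 : (fun k => (Y k : ℝ)) =O[atTop]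
        fun k => |(y k 0 : ℝ)| + (|linErr ξ (y k)| + |sqErr ξ (y k)|) := by
      refine (hy.norm.2.isBigO fun _ => by positivity).trans
        (IsBigO.of_bound (1 + |ξ| + ξ ^ 2) (Eventually.of_forall fun k => ?_))
      rw [Real.norm_of_nonneg (h0 k), Real.norm_of_nonneg (by positivity)]
      set a := |(y k 0 : ℝ)|
      have e1 : |(y k 1 : ℝ)| ≤ |ξ| * a + |linErr ξ (y k)| := by
        rw [← abs_mul]
        refine le_trans (le_of_eq ?_) (abs_add_le _ _)
        rw [linErr]; ring_nf
      have e2 : |(y k 2 : ℝ)| ≤ ξ ^ 2 * a + |sqErr ξ (y k)| := by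
        rw [← abs_of_nonneg (sq_nonneg ξ), ← abs_mul]
        refine le_trans (le_of_eq ?_) (abs_add_le _ _)
        rw [sqErr]; ring_nf
      have p1 : 0 ≤ a := abs_nonneg _
      have p2 := abs_nonneg (linErr ξ (y k))
      have p3 := abs_nonneg (sqErr ξ (y k))
      have p4 := abs_nonneg ξ
      have p5 := sq_nonneg ξ
      have q1 : |ξ| * a ≤ (|ξ| + ξ ^ 2) * (a + (|linErr ξ (y k)| + |sqErr ξ (y k)|)) := by
        gcongr <;> linarith
      have q2 : ξ ^ 2 * a ≤ (|ξ| + ξ ^ 2) * (a + (|linErr ξ (y k)| + |sqErr ξ (y k)|)) := by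
        gcongr <;> linarith
      have q3 : 0 ≤ (|ξ| + ξ ^ 2) * (a + (|linErr ξ (y k)| + |sqErr ξ (y k)|)) := by positivity
      rw [maxNorm, add_assoc, add_mul, one_mul]
      refine max_le ?_ (max_le ?_ ?_) <;> linarith
    have h2 : (fun k => |linErr ξ (y k)| + |sqErr ξ (y k)|) =o[atTop] fun k => (Y k : ℝ) :=
      ((hy.linErr_isBigO.abs_left).add (hy.sqErr_isBigO.abs_left)).trans_isLittleO hy.inv_isLittleO
    obtain ⟨C, hC0, hC⟩ := h1.exists_pos
    rw [← isBigO_abs_right]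
    refine IsBigO.of_bound (2 * C) ?_
    filter_upwards [hC.bound, h2.bound (show 0 < 1 / (2 * C) by positivity)] with k hk1 hk2
    rw [Real.norm_of_nonneg (by positivity), Real.norm_of_nonneg (by positivity)] at *
    have : C * (1 / (2 * C) * (Y k : ℝ)) = Y k / 2 := by field_simp
    have := mul_le_mul_of_nonneg_left hk2 hC0.le
    nlinarith

/-- As `symDet (y k)` is a nonzero integer and `linErr` tends to zero, `|y_{k,0} tanErr|` is bounded
below. -/
theorem tanErr_isTheta (hy : IsApproxPair ξ Y y) :
    (fun k => tanErr ξ (y k)) =Θ[atTop] fun k => (Y k : ℝ)⁻¹ := by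
  refine ⟨hy.tanErr_isBigO, ?_⟩
  have h1 : (fun k => linErr ξ (y k) ^ 2) =o[atTop] fun _ => (1 : ℝ) := by
    rw [isLittleO_one_iff]
    have := hy.linErr_isBigO.trans_tendsto (tendsto_inv_atTop_zero.comp hy.tendsto)
    simpa using this.pow 2
  have h2 : (fun _ : ℕ => (1 : ℝ)) =O[atTop] fun k => (symDet (y k) : ℝ) := by
    refine IsBigO.of_bound 1 ?_
    filter_upwards [eventually_ge_atTop 1] with k hk
    have := hy.one_le_symDet k hk
    rw [one_mul, norm_one, Real.norm_eq_abs]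
    exact_mod_cast this
  have h3 : (fun _ : ℕ => (1 : ℝ)) =O[atTop] fun k => (y k 0 : ℝ) * tanErr ξ (y k) := by
    have h4 := h2.trans ((h1.trans_isBigO h2).right_isBigO_add)
    refine h4.congr_right fun k => ?_
    rw [symDet_eq ξ]; ring
  have h4 := (isBigO_refl (fun k => (Y k : ℝ)⁻¹) atTop).mul
    (h3.trans (hy.zero_isTheta.1.mul (isBigO_refl (fun k => tanErr ξ (y k)) atTop)))
  refine h4.congr' (Eventually.of_forall fun k => mul_one _) ?_
  filter_upwards [hy.tendsto.eventually_gt_atTop 0] with k hk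
  field_simp

/-! ### Growth of the sequence and cross products -/

theorem div_isBigO_div (hy : IsApproxPair ξ Y y) {i j : ℕ} (hij : i ≤ j) :
    (fun k => (Y (k + i) : ℝ) * (Y (k + j) : ℝ)⁻¹) =O[atTop]
      fun k => (Y (k + j) : ℝ) * (Y (k + i) : ℝ)⁻¹ := by
  refine IsBigO.of_bound 1 ?_
  filter_upwards [eventually_ge_atTop 1, hy.eventually_pos i] with k hk hi
  have h : (Y (k + i) : ℝ) ≤ Y (k + j) := by
    exact_mod_cast hy.le_of_le (show 1 ≤ k + i by omega) (show k + i ≤ k + j by omega)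
  rw [one_mul, Real.norm_of_nonneg (by positivity), Real.norm_of_nonneg (by positivity)]
  gcongr

theorem inv_mul_inv_isBigO (hy : IsApproxPair ξ Y y) (i j : ℕ) :
    (fun k => (Y (k + i) : ℝ)⁻¹ * (Y (k + j) : ℝ)⁻¹) =O[atTop]
      fun k => (Y (k + j) : ℝ) * (Y (k + i) : ℝ)⁻¹ := by
  have h : (fun k => (Y (k + j) : ℝ)⁻¹) =O[atTop] fun k => (Y (k + j) : ℝ) :=
    hy.inv_isLittleO.isBigO.comp_tendsto (tendsto_add_atTop_nat j)
  exact (h.mul (isBigO_refl _ _)).congr_left fun k => mul_comm _ _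

theorem cross_isBigO (hy : IsApproxPair ξ Y y) {i j : ℕ} (hij : i ≤ j) (a : Fin 3) :
    (fun k => ((y (k + i) ⨯₃ y (k + j)) a : ℝ)) =O[atTop]
      fun k => (Y (k + j) : ℝ) * (Y (k + i) : ℝ)⁻¹ := by
  have z (i : ℕ) := hy.zero_isTheta.1.comp_tendsto (tendsto_add_atTop_nat i)
  have l (i : ℕ) := hy.linErr_isBigO.comp_tendsto (tendsto_add_atTop_nat i)
  have s (i : ℕ) := hy.sqErr_isBigO.comp_tendsto (tendsto_add_atTop_nat i)
  have h1 := hy.div_isBigO_div hij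
  have h2 := hy.inv_mul_inv_isBigO i j
  fin_cases a
  · refine IsBigO.congr_left ?_ fun k => (cross_zero_eq ξ (y (k + i)) (y (k + j))).symm
    refine ((z j).mul (((l i).const_mul_left _).sub ((s i).const_mul_left _))).add (.add ?_ ?_)
    · exact ((z i).mul (((s j).const_mul_left _).sub ((l j).const_mul_left _))).trans h1
    · exact (((l i).mul (s j)).trans h2).sub (((s i).mul (l j)).trans h2)
  · refine IsBigO.congr_left ?_ fun k => (cross_one_eq ξ (y (k + i)) (y (k + j))).symm
    exact ((z j).mul (s i)).sub (((z i).mul (s j)).trans h1)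
  · refine IsBigO.congr_left ?_ fun k => (cross_two_eq ξ (y (k + i)) (y (k + j))).symm
    exact (((z i).mul (l j)).trans h1).sub ((z j).mul (l i))

/-- Inversion of `Y_{k+1} ∼ Y_k ^ γ`, with `1 / γ = γ - 1`. -/
theorem prev_isTheta (hy : IsApproxPair ξ Y y) :
    (fun k => (Y k : ℝ)) =Θ[atTop] fun k => (Y (k + 1) : ℝ) ^ (Real.goldenRatio - 1) := by
  have h := hy.succ_isTheta.symm.rpow (r := Real.goldenRatio⁻¹)
    (Eventually.of_forall fun k => by positivity) (Eventually.of_forall fun k => by positivity)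
  have e : Real.goldenRatio⁻¹ = Real.goldenRatio - 1 := by
    rw [Real.inv_goldenRatio, ← Real.one_sub_goldenConj]; ring
  rw [e] at h
  refine EventuallyEq.trans_isTheta (Eventually.of_forall fun k => ?_) h
  rw [← e]
  exact (Real.rpow_rpow_inv (Nat.cast_nonneg _) Real.goldenRatio_ne_zero).symm

theorem one_zero_isTheta (hy : IsApproxPair ξ Y y) :
    (fun k => (Y (k + 1) : ℝ) * (Y k : ℝ)⁻¹) =Θ[atTop]
      fun k => (Y (k + 1) : ℝ) ^ (2 - Real.goldenRatio) := by
  refine ((isTheta_refl _ _).mul hy.prev_isTheta.inv).trans_eventuallyEq ?_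
  filter_upwards [hy.eventually_pos 1] with k hk
  rw [← Real.rpow_neg hk.le]
  nth_rw 1 [← Real.rpow_one (Y (k + 1) : ℝ)]
  rw [← Real.rpow_add hk]; ring_nf

theorem two_isTheta (hy : IsApproxPair ξ Y y) :
    (fun k => (Y (k + 2) : ℝ)) =Θ[atTop] fun k => (Y (k + 1) : ℝ) ^ Real.goldenRatio :=
  ⟨hy.succ_isTheta.1.comp_tendsto (tendsto_add_atTop_nat 1),
    hy.succ_isTheta.2.comp_tendsto (tendsto_add_atTop_nat 1)⟩

theorem two_one_isTheta (hy : IsApproxPair ξ Y y) :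
    (fun k => (Y (k + 2) : ℝ) * (Y (k + 1) : ℝ)⁻¹) =Θ[atTop]
      fun k => (Y (k + 1) : ℝ) ^ (Real.goldenRatio - 1) := by
  refine (hy.two_isTheta.mul (isTheta_refl _ _)).trans_eventuallyEq ?_
  filter_upwards [hy.eventually_pos 1] with k hk
  rw [Real.rpow_sub hk, Real.rpow_one, div_eq_mul_inv]

theorem two_zero_isTheta (hy : IsApproxPair ξ Y y) :
    (fun k => (Y (k + 2) : ℝ) * (Y k : ℝ)⁻¹) =Θ[atTop] fun k => (Y (k + 1) : ℝ) := by
  refine (hy.two_isTheta.mul hy.prev_isTheta.inv).trans_eventuallyEq ?_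
  filter_upwards [hy.eventually_pos 1] with k hk
  rw [← Real.rpow_neg hk.le, ← Real.rpow_add hk]
  ring_nf
  exact Real.rpow_one _

theorem tendsto_rpow (hy : IsApproxPair ξ Y y) {s : ℝ} (hs : 0 < s) :
    Tendsto (fun k => (Y (k + 1) : ℝ) ^ s) atTop atTop :=
  (tendsto_rpow_atTop hs).comp ((tendsto_add_atTop_iff_nat 1).2 hy.tendsto)

theorem rpow_isLittleO (hy : IsApproxPair ξ Y y) {s t : ℝ} (hst : s < t) :
    (fun k => (Y (k + 1) : ℝ) ^ s) =o[atTop] fun k => (Y (k + 1) : ℝ) ^ t := by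
  have h : (fun k => (Y (k + 1) : ℝ) ^ (s - t)) =o[atTop] fun _ => (1 : ℝ) := by
    rw [isLittleO_one_iff]
    have := (hy.tendsto_rpow (sub_pos.2 hst)).inv_tendsto_atTop
    refine this.congr fun k => ?_
    rw [Pi.inv_apply, ← Real.rpow_neg (by positivity), neg_sub]
  refine ((isBigO_refl (fun k => (Y (k + 1) : ℝ) ^ t) atTop).mul_isLittleO h).congr'
    ?_ (Eventually.of_forall fun k => mul_one _)
  filter_upwards [hy.eventually_pos 1] with k hk
  rw [← Real.rpow_add hk]
  ring_nf

theorem rpow_isBigO (hy : IsApproxPair ξ Y y) {s t : ℝ} (hst : s ≤ t) :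
    (fun k => (Y (k + 1) : ℝ) ^ s) =O[atTop] fun k => (Y (k + 1) : ℝ) ^ t := by
  rcases hst.eq_or_lt with rfl | h
  · exact isBigO_refl _ _
  · exact (hy.rpow_isLittleO h).isBigO

theorem tendsto_one_zero (hy : IsApproxPair ξ Y y) :
    Tendsto (fun k => (Y (k + 1) : ℝ) * (Y k : ℝ)⁻¹) atTop atTop := by
  have h := hy.one_zero_isTheta.tendsto_norm_atTop_iff.2
    (tendsto_norm_atTop_atTop.comp (hy.tendsto_rpow (by linarith [Real.goldenRatio_lt_two])))
  exact h.congr fun k => Real.norm_of_nonneg (by positivity)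

theorem div_isLittleO_div (hy : IsApproxPair ξ Y y) {i j : ℕ} (hij : i < j) :
    (fun k => (Y (k + i) : ℝ) * (Y (k + j) : ℝ)⁻¹) =o[atTop]
      fun k => (Y (k + j) : ℝ) * (Y (k + i) : ℝ)⁻¹ := by
  have h1 := hy.tendsto_one_zero
  have h2 : Tendsto (fun k => (Y (k + j) : ℝ) * (Y (k + i) : ℝ)⁻¹) atTop atTop := by
    refine tendsto_atTop_mono' _ ?_ (h1.comp (tendsto_add_atTop_nat i))
    filter_upwards [eventually_ge_atTop 1] with k hk
    have : (Y (k + i + 1) : ℝ) ≤ Y (k + j) := by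
      exact_mod_cast hy.le_of_le (show 1 ≤ k + i + 1 by omega) (by omega)
    simp only [Function.comp]
    gcongr
  refine ((tendsto_inv_atTop_zero.comp h2).isBigO_one ℝ |>.trans_isLittleO
    (isLittleO_const_left.2 (Or.inr (tendsto_norm_atTop_atTop.comp h2)))).congr_left fun k => ?_
  simp [mul_comm]

/-- In `tangent ξ (y_i × y_j)` the term `y_{j,0} tanErr(y_i)` dominates, so that the general upper
bound `cross_isBigO` is sharp for this combination of coordinates. -/
theorem cross_tangent_isTheta (hy : IsApproxPair ξ Y y) {i j : ℕ} (hij : i < j) :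
    (fun k => tangent ξ (y (k + i) ⨯₃ y (k + j)))
      =Θ[atTop] fun k => (Y (k + j) : ℝ) * (Y (k + i) : ℝ)⁻¹ := by
  have z (i : ℕ) : (fun k => (y (k + i) 0 : ℝ)) =Θ[atTop] fun k => (Y (k + i) : ℝ) :=
    ⟨hy.zero_isTheta.1.comp_tendsto (tendsto_add_atTop_nat i),
      hy.zero_isTheta.2.comp_tendsto (tendsto_add_atTop_nat i)⟩
  have t (i : ℕ) : (fun k => tanErr ξ (y (k + i))) =Θ[atTop] fun k => (Y (k + i) : ℝ)⁻¹ :=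
    ⟨hy.tanErr_isTheta.1.comp_tendsto (tendsto_add_atTop_nat i),
      hy.tanErr_isTheta.2.comp_tendsto (tendsto_add_atTop_nat i)⟩
  have h1 := (z j).mul (t i)
  have h2 := ((z i).mul (t j)).trans_isLittleO (hy.div_isLittleO_div hij)
  have h3 := h1.add_isLittleO h2.neg_left
  refine EventuallyEq.trans_isTheta (Eventually.of_forall fun k => ?_) h3
  simp only [tangent_cross, Pi.add_apply]
  ring

end IsApproxPair

/-! ### The repulsion property -/

/-- Cramer's rule `det(x,z,w) v = det(v,z,w) x + det(x,v,w) z + det(x,z,v) w`, when `v` begins with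
`(z₁, z₂)`: its first two coordinates are combined so as to eliminate `z`. -/
theorem det3_mul_symDet_eq (x z w v : Fin 3 → ℤ) (h0 : v 0 = z 1) (h1 : v 1 = z 2) :
    det3 x z w * symDet z = det3 v z w * -(x ⨯₃ z) 2 + det3 x z v * (z ⨯₃ w) 2 := by
  simp [det3, symDet, Matrix.det_fin_three, cross_apply, Matrix.of_apply, h0, h1]
  ring

/-- Since `det(x,z,z) = 0`, the vector `v`, which begins with `(z₁, z₂)`, can be replaced by the
small vector `v - ξ z`. -/
theorem det3_shift_eq (ξ : ℝ) (x z v : Fin 3 → ℤ) (h0 : v 0 = z 1) (h1 : v 1 = z 2) :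
    (det3 x z v : ℝ) = ((x ⨯₃ z) 0 : ℝ) * linErr ξ z
      + (((x ⨯₃ z) 1 : ℝ) * (sqErr ξ z - ξ * linErr ξ z)
        + ((x ⨯₃ z) 2 : ℝ) * ((v 2 - z 0 * ξ ^ 3) - ξ * sqErr ξ z)) := by
  simp [det3, Matrix.det_fin_three, cross_apply, Matrix.of_apply, h0, h1, linErr, sqErr]
  ring

theorem exists_pos_le_abs_sub {ξ : ℝ} (hξ : Irrational ξ) (M : ℤ) :
    ∃ ε > 0, ∀ n : ℤ, n ≠ 0 → |n| ≤ M → ∀ m : ℤ, ε ≤ |ξ * n - m| := by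
  have h : ∀ᶠ ε in 𝓝[>] (0 : ℝ), ∀ n ∈ Finset.Icc (-M) M, n ≠ 0 →
      ε ≤ |ξ * n - round (ξ * n)| := by
    rw [Filter.eventually_all_finset]
    intro n _
    rw [Filter.eventually_imp_distrib_left]
    intro hn
    have hpos : 0 < |ξ * n - round (ξ * n)| :=
      abs_pos.2 (sub_ne_zero.2 ((hξ.mul_intCast hn).ne_int _))
    exact eventually_nhdsWithin_of_eventually_nhds (eventually_le_nhds hpos)
  obtain ⟨ε, hε, hε0⟩ := (h.and self_mem_nhdsWithin).exists
  exact ⟨ε, hε0, fun n hn hnM m =>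
    (hε n (Finset.mem_Icc.2 (abs_le.1 hnM)) hn).trans (round_le _ _)⟩

/-- The numbers `y_{k,0} ξ³` cannot be approximated by integers to within `Y_k ^ (-δ)` with
`δ > 2 - γ = 1 / γ²`, even along a subsequence. Otherwise `v_k = (y_{k,1}, y_{k,2}, m_k)` would be
nearly `ξ y_k`, the integer `det(y_{k-1}, y_k, v_k)` would vanish, and `det3_mul_symDet_eq` would
bound the nonzero integer `N = y_{k-1,0} y_{k,1} - y_{k-1,1} y_{k,0}`. But
`y_{k-1,0} y_{k,2} - y_{k-1,1} y_{k,1}` is an integer approaching `ξ N`, which is impossible for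
bounded `N ≠ 0` because `ξ` is irrational. The index is shifted by one, so that `k - 1` does not
occur. -/
theorem IsApproxPair.not_isBigO_rpow {ξ : ℝ} {Y : ℕ → ℕ} {y : ℕ → Fin 3 → ℤ}
    (hy : IsApproxPair ξ Y y) (hξ : Irrational ξ) {l : Filter ℕ} [l.NeBot] (hl : l ≤ atTop)
    {δ : ℝ} (hδ : 2 - Real.goldenRatio < δ) (m : ℕ → ℤ) :
    ¬ (fun k => (m k : ℝ) - y (k + 1) 0 * ξ ^ 3) =O[l] fun k => (Y (k + 1) : ℝ) ^ (-δ) := by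
  intro hm
  -- the other errors are of order `Y⁻¹`, so an exponent beyond `1` is of no use
  set s := min δ 1 with hs
  have hs1 : 2 - Real.goldenRatio < s :=
    lt_min hδ (by linarith [Real.one_lt_goldenRatio])
  have hinv : (fun k => (Y (k + 1) : ℝ)⁻¹) =O[l] fun k => (Y (k + 1) : ℝ) ^ (-s) := by
    refine IsBigO.mono ?_ hl
    refine (hy.rpow_isBigO (show (-1 : ℝ) ≤ -s from neg_le_neg (min_le_right _ _))).congr_left
      fun k => Real.rpow_neg_one _
  have hm' := hm.trans ((hy.rpow_isBigO (neg_le_neg (min_le_left δ 1))).mono hl)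
  have hlin : (fun k => linErr ξ (y (k + 1))) =O[l] fun k => (Y (k + 1) : ℝ) ^ (-s) :=
    ((hy.linErr_isBigO.comp_tendsto (tendsto_add_atTop_nat 1)).mono hl).trans hinv
  have hsq : (fun k => sqErr ξ (y (k + 1))) =O[l] fun k => (Y (k + 1) : ℝ) ^ (-s) :=
    ((hy.sqErr_isBigO.comp_tendsto (tendsto_add_atTop_nat 1)).mono hl).trans hinv
  have hX (a : Fin 3) : (fun k => ((y k ⨯₃ y (k + 1)) a : ℝ)) =O[l]
      fun k => (Y (k + 1) : ℝ) ^ (2 - Real.goldenRatio) :=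
    ((hy.cross_isBigO (Nat.zero_le 1) a).trans hy.one_zero_isTheta.1).mono hl
  let v (k : ℕ) : Fin 3 → ℤ := ![y (k + 1) 1, y (k + 1) 2, m k]
  -- the determinants `det (y_k, y_{k+1}, v_k)` are integers tending to zero
  have hC : Tendsto (fun k => (det3 (y k) (y (k + 1)) (v k) : ℝ)) l (𝓝 0) := by
    have h1 : (fun k => (det3 (y k) (y (k + 1)) (v k) : ℝ)) =O[l]
        fun k => (Y (k + 1) : ℝ) ^ (2 - Real.goldenRatio) * (Y (k + 1) : ℝ) ^ (-s) := by
      refine IsBigO.congr_left ?_ fun k => (det3_shift_eq ξ _ _ (v k) rfl rfl).symm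
      exact ((hX 0).mul hlin).add (((hX 1).mul (hsq.sub (hlin.const_mul_left _))).add
        ((hX 2).mul (hm'.sub (hsq.const_mul_left _))))
    refine h1.trans_tendsto ?_
    have h2 := (hy.tendsto_rpow (sub_pos.2 hs1)).inv_tendsto_atTop.mono_left hl
    refine h2.congr' ?_
    filter_upwards [hl (hy.eventually_pos 1)] with k hk
    rw [Pi.inv_apply, ← Real.rpow_neg hk.le, ← Real.rpow_add hk]
    ring_nf
  have hC0 : ∀ᶠ k in l, det3 (y k) (y (k + 1)) (v k) = 0 := by
    filter_upwards [hC.eventually (Metric.ball_mem_nhds 0 one_pos)] with k hk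
    rw [Real.dist_0_eq_abs] at hk
    exact Int.abs_lt_one_iff.1 (by exact_mod_cast hk)
  obtain ⟨c, -, hc⟩ := hy.det3_bounded
  obtain ⟨c', -, hc'⟩ := hy.symDet_bounded
  obtain ⟨M, hM⟩ := exists_nat_ge (c * c')
  obtain ⟨ε, hε, hεM⟩ := exists_pos_le_abs_sub hξ M
  have hN : Tendsto (fun k => ξ * ((y k ⨯₃ y (k + 1)) 2 : ℤ) -
      ((y k 0 * y (k + 1) 2 - y k 1 * y (k + 1) 1 : ℤ) : ℝ)) atTop (𝓝 0) := by
    have h1 : (fun k => (y k 1 : ℝ)) =O[atTop] fun k => (Y k : ℝ) := by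
      refine ((hy.zero_isTheta.1.const_mul_left ξ).add
        (hy.linErr_isBigO.trans hy.inv_isLittleO.isBigO)).congr_left fun k => ?_
      rw [linErr]; ring
    have h2 := hy.linErr_isBigO.comp_tendsto (tendsto_add_atTop_nat 1)
    have h3 := hy.sqErr_isBigO.comp_tendsto (tendsto_add_atTop_nat 1)
    have h4 : Tendsto (fun k => (Y k : ℝ) * (Y (k + 1) : ℝ)⁻¹) atTop (𝓝 0) :=
      (tendsto_inv_atTop_zero.comp hy.tendsto_one_zero).congr fun k => by simp [mul_comm]
    refine (((h1.mul h2).sub (hy.zero_isTheta.1.mul (h3.sub (h2.const_mul_left ξ)))).trans_tendsto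
      h4).congr fun k => ?_
    simp [cross_apply, linErr, sqErr]
    ring
  have hfin : ∀ᶠ k in l, False := by
    filter_upwards [hC0, hl (eventually_ge_atTop 1),
      hl (hN.eventually (Metric.ball_mem_nhds 0 hε))] with k hk hk1 hk2
    rw [Real.dist_0_eq_abs] at hk2
    have key := det3_mul_symDet_eq (y k) (y (k + 1)) (y (k + 2)) (v k) rfl rfl
    rw [hk, zero_mul, add_zero] at key
    have hd := hy.one_le_det3 k hk1
    have hs := hy.one_le_symDet (k + 1) (by omega)
    have h1 : 1 ≤ |det3 (v k) (y (k + 1)) (y (k + 2)) * -(y k ⨯₃ y (k + 1)) 2| := by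
      rw [← key, abs_mul]; nlinarith
    have hA : det3 (v k) (y (k + 1)) (y (k + 2)) ≠ 0 := fun h => by simp [h] at h1
    have hn : (y k ⨯₃ y (k + 1)) 2 ≠ 0 := fun h => by simp [h] at h1
    refine absurd (hεM _ hn ?_ _) (not_le.2 hk2)
    have h2 : |(y k ⨯₃ y (k + 1)) 2|
        ≤ |det3 (y k) (y (k + 1)) (y (k + 2))| * |symDet (y (k + 1))| := by
      rw [← abs_mul, key, abs_mul, abs_neg]
      exact le_mul_of_one_le_left (abs_nonneg _) (Int.one_le_abs hA)
    have h3 := hc k hk1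
    have h4 := hc' (k + 1) (by omega)
    simp only [mul_one] at h3 h4
    have h5 : (0 : ℝ) ≤ (|symDet (y (k + 1))| : ℤ) := by exact_mod_cast abs_nonneg _
    have h6 : (0 : ℝ) ≤ (|det3 (y k) (y (k + 1)) (y (k + 2))| : ℤ) := by
      exact_mod_cast abs_nonneg _
    have h7 : ((|(y k ⨯₃ y (k + 1)) 2| : ℤ) : ℝ) ≤ M :=
      le_trans (by exact_mod_cast h2)
        ((mul_le_mul h3 h4 h5 (h6.trans h3)).trans hM)
    exact_mod_cast h7
  exact hfin.exists.choose_spec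

/-! ### Interpolation -/

theorem eq_zero_of_quadratic_eq_zero {ξ : ℝ} (hξ : IsExtremal ξ) {a b c : ℤ}
    (h : (a : ℝ) + b * ξ + c * ξ ^ 2 = 0) : a = 0 ∧ b = 0 ∧ c = 0 := by
  obtain ⟨hirr, hquad, -⟩ := hξ
  have hc : c = 0 := by
    by_contra hc
    apply hquad
    let P : Polynomial ℚ := Polynomial.C (c : ℚ) * Polynomial.X ^ 2
      + Polynomial.C (b : ℚ) * Polynomial.X + Polynomial.C (a : ℚ)
    have hdeg : P.natDegree = 2 := Polynomial.natDegree_quadratic (by exact_mod_cast hc)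
    have hP0 : P ≠ 0 := fun h0 => by simp [h0] at hdeg
    have hroot : Polynomial.aeval ξ P = 0 := by
      simp [P]
      linarith
    have halg : IsAlgebraic ℚ ξ := ⟨P, hP0, hroot⟩
    refine ⟨halg, le_antisymm ?_ ?_⟩
    · rw [← hdeg]
      exact Polynomial.natDegree_le_of_dvd (minpoly.dvd ℚ ξ hroot) hP0
    · rw [minpoly.two_le_natDegree_iff halg.isIntegral]
      rintro ⟨q, hq⟩
      exact hirr ⟨q, by simpa using hq⟩
  subst hc
  have hb : b = 0 := by
    by_contra hb
    refine (hirr.intCast_mul hb).ne_int (-a) ?_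
    push_cast at h ⊢
    linarith
  subst hb
  refine ⟨?_, rfl, rfl⟩
  simpa using h

/-- A multiple of `n` at distance between `n` and `2 n` from `t`, on the side prescribed by the sign
of `σ`. -/
theorem exists_int_mul_sub (t σ : ℝ) {n : ℕ} (hn : 0 < n) :
    ∃ m : ℤ, (n : ℝ) ≤ |n * m - t| ∧ |n * m - t| ≤ 2 * n ∧ 0 ≤ (n * m - t) * σ := by
  have hn' : (0 : ℝ) < n := by exact_mod_cast hn
  have ht : (n : ℝ) * (t / n) = t := by field_simp
  rcases le_total 0 σ with hσ | hσ
  · have h1 := mul_le_mul_of_nonneg_left (Int.le_ceil (t / n)) hn'.le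
    have h2 := mul_le_mul_of_nonneg_left (Int.ceil_lt_add_one (t / n)).le hn'.le
    refine ⟨⌈t / n⌉ + 1, ?_⟩
    push_cast
    rw [abs_of_nonneg (by linarith)]
    exact ⟨by linarith, by linarith, mul_nonneg (by linarith) hσ⟩
  · have h1 := mul_le_mul_of_nonneg_left (Int.floor_le (t / n)) hn'.le
    have h2 := mul_le_mul_of_nonneg_left (Int.lt_floor_add_one (t / n)).le hn'.le
    refine ⟨⌊t / n⌋ - 1, ?_⟩
    push_cast
    rw [abs_of_nonpos (by linarith)]
    exact ⟨by linarith, by linarith, mul_nonneg_of_nonpos_of_nonpos (by linarith) hσ⟩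

/-- An integral linear form `v ↦ c₀ v₀ + c₁ v₁ + c₂ v₂` with prescribed values at `x`, `z`, `w`, by
Cramer's rule: the values are multiples of `n`, which `det(x,z,w)` divides, so `c` is integral. The
second formula is Cramer's rule for the real linear form `c - (t, 0, 0)`. -/
theorem exists_interpolation (t : ℝ) (x z w : Fin 3 → ℤ) {n : ℤ}
    (hdvd : det3 x z w ∣ n) (m₀ m₁ m₂ : ℤ) :
    ∃ c : Fin 3 → ℤ, (c 0 : ℝ) * w 0 + c 1 * w 1 + c 2 * w 2 = n * m₂ ∧
      ∀ a, (det3 x z w : ℝ) * (c a - (Pi.single 0 t : Fin 3 → ℝ) a) =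
        (n * m₀ - x 0 * t) * ((z ⨯₃ w) a : ℤ) - (n * m₁ - z 0 * t) * ((x ⨯₃ w) a : ℤ)
          + (n * m₂ - w 0 * t) * ((x ⨯₃ z) a : ℤ) := by
  obtain ⟨s, rfl⟩ := hdvd
  refine ⟨fun a => s * (m₀ * (z ⨯₃ w) a - m₁ * (x ⨯₃ w) a + m₂ * (x ⨯₃ z) a), ?_, fun a => ?_⟩
  · norm_cast
    simp [det3, Matrix.det_fin_three, cross_apply, Matrix.of_apply]
    ring
  · fin_cases a
    all_goals
      simp [det3, Matrix.det_fin_three, cross_apply, Matrix.of_apply]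
      ring

/-- The signed distance from `t` to a nearest multiple of `n`. -/
noncomputable def nearErr (n : ℕ) (t : ℝ) : ℝ := n * round (t / n) - t

theorem abs_nearErr {n : ℕ} (hn : 0 < n) (t : ℝ) : |nearErr n t| = n * distInt (t / n) := by
  have hn' : (0 : ℝ) < n := by exact_mod_cast hn
  rw [distInt, ← abs_of_pos hn', ← abs_mul, abs_of_pos hn', ← abs_neg]
  congr 1
  rw [nearErr]
  field_simp
  ring

theorem abs_nearErr_le {n : ℕ} (hn : 0 < n) (t : ℝ) : |nearErr n t| ≤ n := by
  rw [abs_nearErr hn]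
  have := abs_sub_round (t / n)
  exact mul_le_of_le_one_right (Nat.cast_nonneg _) (by unfold distInt; linarith)

/-- The coefficients `c` of a polynomial `T³ - c₂ T² - c₁ T - c₀`. The linear form `c - (ξ³, 0, 0)`
takes the values `e₀`, `nearErr n (z₀ ξ³)` and `e₂` at `x`, `z` and `w`. The value at `z` is as small
as possible, while `e₀` is kept away from zero and its sign excludes cancellation between the first
two terms of Cramer's formula for the derivative at `ξ`. -/
theorem exists_cubic (ξ : ℝ) (x z w : Fin 3 → ℤ) {n : ℕ} (hn : 0 < n)
    (hdvd : det3 x z w ∣ (n : ℤ)) :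
    ∃ (c : Fin 3 → ℤ) (e₀ e₂ : ℝ), (n : ℝ) ≤ |e₀| ∧ |e₀| ≤ 2 * n ∧ |e₂| ≤ n ∧
      0 ≤ (e₀ * tangent ξ (z ⨯₃ w)) * -(nearErr n (z 0 * ξ ^ 3) * tangent ξ (x ⨯₃ w)) ∧
      (c 0 : ℝ) * w 0 + c 1 * w 1 + c 2 * w 2 = w 0 * ξ ^ 3 + e₂ ∧
      ∀ a, (det3 x z w : ℝ) * (c a - (Pi.single 0 (ξ ^ 3) : Fin 3 → ℝ) a) =
        e₀ * ((z ⨯₃ w) a : ℤ) - nearErr n (z 0 * ξ ^ 3) * ((x ⨯₃ w) a : ℤ)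
          + e₂ * ((x ⨯₃ z) a : ℤ) := by
  obtain ⟨m₀, h1, h2, h3⟩ := exists_int_mul_sub (x 0 * ξ ^ 3)
    (tangent ξ (z ⨯₃ w) * -(nearErr n (z 0 * ξ ^ 3) * tangent ξ (x ⨯₃ w))) hn
  obtain ⟨c, hc1, hc2⟩ := exists_interpolation (ξ ^ 3) x z w hdvd m₀
    (round (z 0 * ξ ^ 3 / n)) (round (w 0 * ξ ^ 3 / n))
  refine ⟨c, n * m₀ - x 0 * ξ ^ 3, nearErr n (w 0 * ξ ^ 3), h1, h2, abs_nearErr_le hn _, ?_, ?_,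
    fun a => ?_⟩
  · rw [mul_assoc]; exact h3
  · rw [hc1, nearErr]; push_cast; ring
  · rw [hc2]; simp only [nearErr, Int.cast_natCast]

/-! ### Size of the interpolating cubics -/

/-- A sequence of integral vectors `c k` as supplied by `exists_cubic` for the triples
`y k`, `y (k + 1)`, `y (k + 2)`, `k ≥ 1`: the linear form `c k - (ξ³, 0, 0)` has the bounded values
`e₀ k`, `e₁ k`, `e₂ k` there. The associated cubic is `T³ - c₂ T² - c₁ T - c₀`. -/
structure CubicFamily (ξ : ℝ) (y : ℕ → Fin 3 → ℤ) (n : ℕ) (c : ℕ → Fin 3 → ℤ)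
    (e₀ e₁ e₂ : ℕ → ℝ) : Prop where
  le_abs_zero : ∀ k, 1 ≤ k → (n : ℝ) ≤ |e₀ k|
  abs_zero_le : ∀ k, 1 ≤ k → |e₀ k| ≤ 2 * n
  abs_one_le : ∀ k, 1 ≤ k → |e₁ k| ≤ n
  abs_two_le : ∀ k, 1 ≤ k → |e₂ k| ≤ n
  same_sign : ∀ k, 1 ≤ k → 0 ≤ (e₀ k * tangent ξ (y (k + 1) ⨯₃ y (k + 2))) *
    -(e₁ k * tangent ξ (y k ⨯₃ y (k + 2)))
  eval_last : ∀ k, 1 ≤ k → (c k 0 : ℝ) * y (k + 2) 0 + c k 1 * y (k + 2) 1 + c k 2 * y (k + 2) 2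
    = y (k + 2) 0 * ξ ^ 3 + e₂ k
  cramer : ∀ k, 1 ≤ k → ∀ a, (det3 (y k) (y (k + 1)) (y (k + 2)) : ℝ) *
      (c k a - (Pi.single 0 (ξ ^ 3) : Fin 3 → ℝ) a) =
    e₀ k * ((y (k + 1) ⨯₃ y (k + 2)) a : ℤ) - e₁ k * ((y k ⨯₃ y (k + 2)) a : ℤ)
      + e₂ k * ((y k ⨯₃ y (k + 1)) a : ℤ)

/-- The common order of magnitude of the coefficients of the cubic and of its derivative at `ξ`,
namely `Y_{k+2} / Y_{k+1} + |e₁ k| Y_{k+2} / Y_k`. -/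
noncomputable def size (Y : ℕ → ℕ) (e₁ : ℕ → ℝ) (k : ℕ) : ℝ :=
  (Y (k + 2) : ℝ) * (Y (k + 1) : ℝ)⁻¹ + |e₁ k| * ((Y (k + 2) : ℝ) * (Y k : ℝ)⁻¹)

theorem isBigO_one_of_abs_le {e : ℕ → ℝ} {C : ℝ} (h : ∀ k, 1 ≤ k → |e k| ≤ C) :
    e =O[atTop] fun _ => (1 : ℝ) := by
  refine IsBigO.of_bound C ?_
  filter_upwards [eventually_ge_atTop 1] with k hk
  simpa using h k hk

theorem abs_add_eq_of_mul_nonneg {a b : ℝ} (h : 0 ≤ a * b) : |a + b| = |a| + |b| := by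
  rw [abs_add_eq_add_abs_iff]
  rcases mul_nonneg_iff.1 h with h | h
  · exact .inl h
  · exact .inr h

section

variable {ξ : ℝ} {Y : ℕ → ℕ} {y : ℕ → Fin 3 → ℤ} {n : ℕ} {c : ℕ → Fin 3 → ℤ} {e₀ e₁ e₂ : ℕ → ℝ}

theorem IsApproxPair.det3_isTheta (hy : IsApproxPair ξ Y y) :
    (fun k => (det3 (y k) (y (k + 1)) (y (k + 2)) : ℝ)) =Θ[atTop] fun _ => (1 : ℝ) := by
  constructor
  · obtain ⟨C, -, hC⟩ := hy.det3_bounded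
    refine isBigO_one_of_abs_le (C := C) fun k hk => ?_
    simpa using hC k hk
  · refine IsBigO.of_bound 1 ?_
    filter_upwards [eventually_ge_atTop 1] with k hk
    have := hy.one_le_det3 k hk
    rw [one_mul, norm_one, Real.norm_eq_abs]
    exact_mod_cast this

theorem IsApproxPair.tendsto_size (hy : IsApproxPair ξ Y y) (e₁ : ℕ → ℝ) :
    Tendsto (size Y e₁) atTop atTop :=
  tendsto_atTop_mono (fun k => le_add_of_nonneg_right (by positivity))
    (hy.tendsto_one_zero.comp (tendsto_add_atTop_nat 1))

theorem two_one_isBigO_size : (fun k => (Y (k + 2) : ℝ) * (Y (k + 1) : ℝ)⁻¹)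
    =O[atTop] size Y e₁ := by
  refine IsBigO.of_bound 1 (Eventually.of_forall fun k => ?_)
  rw [one_mul, Real.norm_of_nonneg (by positivity),
    Real.norm_of_nonneg (by unfold size; positivity)]
  exact le_add_of_nonneg_right (by positivity)

theorem two_zero_isBigO_size : (fun k => e₁ k * ((Y (k + 2) : ℝ) * (Y k : ℝ)⁻¹))
    =O[atTop] size Y e₁ := by
  refine IsBigO.of_bound 1 (Eventually.of_forall fun k => ?_)
  rw [one_mul, norm_mul, Real.norm_eq_abs, Real.norm_of_nonneg (by positivity),
    Real.norm_of_nonneg (by unfold size; positivity)]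
  exact le_add_of_nonneg_left (by positivity)

theorem IsApproxPair.one_isLittleO_size (hy : IsApproxPair ξ Y y) :
    (fun _ => (1 : ℝ)) =o[atTop] size Y e₁ :=
  isLittleO_const_left.2 (.inr (tendsto_norm_atTop_atTop.comp (hy.tendsto_size e₁)))

theorem IsApproxPair.one_zero_isLittleO (hy : IsApproxPair ξ Y y) :
    (fun k => (Y (k + 1) : ℝ) * (Y k : ℝ)⁻¹) =o[atTop]
      fun k => (Y (k + 2) : ℝ) * (Y (k + 1) : ℝ)⁻¹ := by
  refine hy.one_zero_isTheta.trans_isLittleO (IsLittleO.trans_isTheta (hy.rpow_isLittleO ?_)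
    hy.two_one_isTheta.symm)
  -- `2 - γ < γ - 1`, since `3 < 2 γ`
  nlinarith [Real.goldenRatio_sq, Real.one_lt_goldenRatio]

namespace CubicFamily

theorem coeff_isBigO (h : CubicFamily ξ y n c e₀ e₁ e₂) (hy : IsApproxPair ξ Y y) (a : Fin 3) :
    (fun k => (c k a : ℝ)) =O[atTop] size Y e₁ := by
  have h0 := (isBigO_one_of_abs_le h.abs_zero_le).mul
    ((hy.cross_isBigO (show 1 ≤ 2 by norm_num) a).trans (two_one_isBigO_size (e₁ := e₁)))
  have h1 := ((isBigO_refl e₁ atTop).mul (hy.cross_isBigO (show 0 ≤ 2 by norm_num) a)).trans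
    two_zero_isBigO_size
  have h2 := (isBigO_one_of_abs_le h.abs_two_le).mul
    ((hy.cross_isBigO (show 0 ≤ 1 by norm_num) a).trans
      (hy.one_zero_isLittleO.isBigO.trans (two_one_isBigO_size (e₁ := e₁))))
  simp only [one_mul] at h0 h2
  have h4 : (fun k => (det3 (y k) (y (k + 1)) (y (k + 2)) : ℝ) *
      (c k a - (Pi.single 0 (ξ ^ 3) : Fin 3 → ℝ) a)) =O[atTop] size Y e₁ := by
    refine ((h0.sub h1).add h2).congr' ?_ .rfl
    filter_upwards [eventually_ge_atTop 1] with k hk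
    exact (h.cramer k hk a).symm
  have h5 : (fun k => c k a - (Pi.single 0 (ξ ^ 3) : Fin 3 → ℝ) a) =O[atTop] size Y e₁ := by
    simpa using (hy.det3_isTheta.2.mul (isBigO_refl _ _)).trans h4
  have h6 : (fun _ => (Pi.single 0 (ξ ^ 3) : Fin 3 → ℝ) a) =O[atTop] size Y e₁ :=
    (isBigO_const_const _ one_ne_zero _).trans hy.one_isLittleO_size.isBigO
  simpa using h5.add h6

/-- The coefficient bound `coeff_isBigO` is attained by the derivative at `ξ`: the first two terms of
Cramer's formula have the same sign, and the third is negligible. -/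
theorem size_isBigO_tangent (h : CubicFamily ξ y n c e₀ e₁ e₂) (hn : 0 < n)
    (hy : IsApproxPair ξ Y y) : size Y e₁ =O[atTop] fun k => tangent ξ (c k) := by
  have t01 := hy.cross_tangent_isTheta (show 0 < 1 by norm_num)
  have t02 := hy.cross_tangent_isTheta (show 0 < 2 by norm_num)
  have t12 := hy.cross_tangent_isTheta (show 1 < 2 by norm_num)
  simp only [add_zero] at t01 t02
  -- the two leading terms have the same sign, hence do not cancel
  have hmain : size Y e₁ =O[atTop] fun k => e₀ k * tangent ξ (y (k + 1) ⨯₃ y (k + 2)) +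
      -(e₁ k * tangent ξ (y k ⨯₃ y (k + 2))) := by
    have hn0 : (fun _ => (1 : ℝ)) =O[atTop] e₀ := by
      refine IsBigO.of_bound 1 ?_
      filter_upwards [eventually_ge_atTop 1] with k hk
      rw [norm_one, one_mul]
      exact le_trans (by exact_mod_cast hn) (h.le_abs_zero k hk)
    have a1 : (fun k => (Y (k + 2) : ℝ) * (Y (k + 1) : ℝ)⁻¹) =O[atTop]
        fun k => |e₀ k * tangent ξ (y (k + 1) ⨯₃ y (k + 2))| +
          |e₁ k * tangent ξ (y k ⨯₃ y (k + 2))| := by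
      have := hn0.mul t12.2
      simp only [one_mul] at this
      refine this.trans (IsBigO.of_norm_le fun k => ?_)
      exact le_add_of_nonneg_right (abs_nonneg (e₁ k * tangent ξ (y k ⨯₃ y (k + 2))))
    have a2 : (fun k => |e₁ k| * ((Y (k + 2) : ℝ) * (Y k : ℝ)⁻¹)) =O[atTop]
        fun k => |e₀ k * tangent ξ (y (k + 1) ⨯₃ y (k + 2))| +
          |e₁ k * tangent ξ (y k ⨯₃ y (k + 2))| := by
      refine ((isBigO_refl e₁ atTop).abs_left.mul t02.2).trans (IsBigO.of_norm_le fun k => ?_)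
      exact le_add_of_nonneg_left (abs_nonneg (e₀ k * tangent ξ (y (k + 1) ⨯₃ y (k + 2))))
    refine (a1.add a2).trans (IsBigO.of_bound 1 ?_)
    filter_upwards [eventually_ge_atTop 1] with k hk
    rw [one_mul, Real.norm_of_nonneg (by positivity), Real.norm_eq_abs,
      abs_add_eq_of_mul_nonneg (h.same_sign k hk), abs_neg]
  have hsmall : (fun k => e₂ k * tangent ξ (y k ⨯₃ y (k + 1))) =o[atTop] size Y e₁ := by
    have := (isBigO_one_of_abs_le h.abs_two_le).mul_isLittleO
      ((t01.1.trans_isLittleO hy.one_zero_isLittleO).trans_isBigO (two_one_isBigO_size (e₁ := e₁)))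
    simpa only [one_mul] using this
  have hsum := hmain.trans ((hsmall.trans_isBigO hmain).right_isBigO_add')
  refine (hsum.congr' .rfl ?_).trans (g := fun k =>
    (det3 (y k) (y (k + 1)) (y (k + 2)) : ℝ) * tangent ξ (c k)) ?_
  · filter_upwards [eventually_ge_atTop 1] with k hk
    have e1 := h.cramer k hk 1
    have e2 := h.cramer k hk 2
    simp only [Pi.single_apply, Fin.reduceEq, if_false, sub_zero] at e1 e2
    simp only [tangent, Pi.add_apply]
    linear_combination -e1 - 2 * ξ * e2
  · simpa using hy.det3_isTheta.1.mul (isBigO_refl (fun k => tangent ξ (c k)) atTop)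

theorem size_isBigO_deriv (h : CubicFamily ξ y n c e₀ e₁ e₂) (hn : 0 < n)
    (hy : IsApproxPair ξ Y y) :
    size Y e₁ =O[atTop] fun k => 3 * ξ ^ 2 - (c k 1 + 2 * ξ * c k 2) := by
  have h1 := h.size_isBigO_tangent hn hy
  have h2 : (fun _ => 3 * ξ ^ 2) =o[atTop] fun k => tangent ξ (c k) :=
    ((isBigO_const_const _ one_ne_zero _).trans_isLittleO hy.one_isLittleO_size).trans_isBigO h1
  refine (h1.trans h2.right_isBigO_sub).trans (IsBigO.of_bound 1 (Eventually.of_forall fun k => ?_))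
  rw [one_mul, ← norm_neg, neg_sub, tangent]

/-- The value of the cubic at `ξ` is `O(1 / Y_{k+2})`, because its linear form is bounded at
`y (k + 2)`, which is nearly proportional to `(1, ξ, ξ²)`. -/
theorem eval_isBigO (h : CubicFamily ξ y n c e₀ e₁ e₂) (hy : IsApproxPair ξ Y y) :
    (fun k => ξ ^ 3 - (c k 2 * ξ ^ 2 + c k 1 * ξ + c k 0)) =O[atTop]
      fun k => (Y (k + 2) : ℝ)⁻¹ := by
  have hinv (i : ℕ) : (fun k => (Y (k + i) : ℝ)⁻¹) =O[atTop] fun _ => (1 : ℝ) :=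
    (tendsto_inv_atTop_zero.comp ((tendsto_add_atTop_iff_nat i).2 hy.tendsto)).isBigO_one ℝ
  have hsize : size Y e₁ =O[atTop] fun k => (Y (k + 2) : ℝ) := by
    have a1 := (isBigO_refl (fun k => (Y (k + 2) : ℝ)) atTop).mul (hinv 1)
    have a2 := (isBigO_one_of_abs_le h.abs_one_le).abs_left.mul
      ((isBigO_refl (fun k => (Y (k + 2) : ℝ)) atTop).mul (hinv 0))
    simp only [mul_one, one_mul, add_zero] at a1 a2
    exact a1.add a2
  have hone : (fun k => size Y e₁ k * (Y (k + 2) : ℝ)⁻¹) =O[atTop] fun _ => (1 : ℝ) := by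
    refine (hsize.mul (isBigO_refl _ _)).congr' .rfl ?_
    filter_upwards [hy.eventually_pos 2] with k hk
    exact mul_inv_cancel₀ hk.ne'
  have b1 := ((h.coeff_isBigO hy 1).mul
    (hy.linErr_isBigO.comp_tendsto (tendsto_add_atTop_nat 2))).trans hone
  have b2 := ((h.coeff_isBigO hy 2).mul
    (hy.sqErr_isBigO.comp_tendsto (tendsto_add_atTop_nat 2))).trans hone
  have b3 : (fun k => (Y (k + 2) : ℝ) * (ξ ^ 3 - (c k 2 * ξ ^ 2 + c k 1 * ξ + c k 0))) =O[atTop]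
      fun _ => (1 : ℝ) := by
    refine ((hy.zero_isTheta.2.comp_tendsto (tendsto_add_atTop_nat 2)).mul
      (isBigO_refl _ _)).trans (((b1.add b2).sub (isBigO_one_of_abs_le h.abs_two_le)).congr' ?_ .rfl)
    filter_upwards [eventually_ge_atTop 1] with k hk
    have := h.eval_last k hk
    simp only [Function.comp, linErr, sqErr]
    linear_combination this
  refine ((isBigO_refl (fun k => (Y (k + 2) : ℝ)⁻¹) atTop).mul b3).congr' ?_
    (Eventually.of_forall fun k => mul_one _)
  filter_upwards [hy.eventually_pos 2] with k hk
  field_simp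

end CubicFamily
end

/-! ### Approximation by the roots -/

/-- A bounded sequence of nonzero integers has a common multiple, so `seqLcm` is not the junk
value `0`. -/
theorem seqLcm_spec {d : ℕ → ℤ} {M : ℕ} (h0 : ∀ k, 1 ≤ k → d k ≠ 0)
    (hM : ∀ k, 1 ≤ k → (d k).natAbs ≤ M) :
    0 < seqLcm d ∧ ∀ k, 1 ≤ k → d k ∣ (seqLcm d : ℤ) := by
  have hne : {m : ℕ | 0 < m ∧ ∀ k : ℕ, 1 ≤ k → d k ∣ (m : ℤ)}.Nonempty := by
    refine ⟨M.factorial, M.factorial_pos, fun k hk => ?_⟩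
    rw [← Int.natAbs_dvd, Int.natCast_dvd_natCast]
    exact Nat.dvd_factorial (Int.natAbs_pos.2 (h0 k hk)) (hM k hk)
  exact Nat.sInf_mem hne

theorem IsApproxPair.seqLcm_spec {ξ : ℝ} {Y : ℕ → ℕ} {y : ℕ → Fin 3 → ℤ}
    (hy : IsApproxPair ξ Y y) :
    0 < seqLcm (fun k => det3 (y k) (y (k + 1)) (y (k + 2))) ∧
      ∀ k, 1 ≤ k → det3 (y k) (y (k + 1)) (y (k + 2)) ∣
        (seqLcm (fun k => det3 (y k) (y (k + 1)) (y (k + 2))) : ℤ) := by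
  obtain ⟨C, -, hC⟩ := hy.det3_bounded
  obtain ⟨M, hM⟩ := exists_nat_ge C
  refine CubicApprox.seqLcm_spec (M := M) (fun k hk h0 => ?_) fun k hk => ?_
  · simpa [h0] using hy.one_le_det3 k hk
  · have h1 : ((|det3 (y k) (y (k + 1)) (y (k + 2))| : ℤ) : ℝ) ≤ M :=
      (hC k hk).trans (by simpa using hM)
    have h2 : |det3 (y k) (y (k + 1)) (y (k + 2))| ≤ M := by exact_mod_cast h1
    rw [Int.abs_eq_natAbs] at h2
    exact_mod_cast h2

theorem exists_cubicFamily (ξ : ℝ) {y : ℕ → Fin 3 → ℤ} {n : ℕ} (hn : 0 < n)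
    (hdvd : ∀ k, 1 ≤ k → det3 (y k) (y (k + 1)) (y (k + 2)) ∣ (n : ℤ)) :
    ∃ c e₀ e₂, CubicFamily ξ y n c e₀ (fun k => nearErr n (y (k + 1) 0 * ξ ^ 3)) e₂ := by
  have (k : ℕ) := exists_cubic ξ (y (k + 1)) (y (k + 2)) (y (k + 3)) hn (hdvd (k + 1) (by omega))
  choose c e₀ e₂ h using this
  -- only the triples with `k ≥ 1` are available
  refine ⟨fun k => c (k - 1), fun k => e₀ (k - 1), fun k => e₂ (k - 1), ?_⟩
  constructor
  all_goals
    intro k hk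
    obtain ⟨j, rfl⟩ : ∃ j, k = j + 1 := ⟨k - 1, by omega⟩
    obtain ⟨h1, h2, h3, h4, h5, h6⟩ := h j
    first
    | exact h1
    | exact h2
    | exact h3
    | exact h4
    | exact h5
    | exact h6
    | exact abs_nearErr_le hn _

/-- The number `ξ` itself might be a cubic integer, but it is a root of finitely many of the
cubics only. -/
theorem CubicFamily.eventually_ne {ξ : ℝ} (hξ : IsExtremal ξ) {Y : ℕ → ℕ} {y : ℕ → Fin 3 → ℤ}
    (hy : IsApproxPair ξ Y y) {n : ℕ} (hn : 0 < n) {c : ℕ → Fin 3 → ℤ} {e₀ e₁ e₂ : ℕ → ℝ}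
    (h : CubicFamily ξ y n c e₀ e₁ e₂) :
    ∀ᶠ k in atTop, ξ ^ 3 ≠ c k 2 * ξ ^ 2 + c k 1 * ξ + c k 0 := by
  by_contra hcon
  have hfreq : ∃ᶠ k in atTop, ξ ^ 3 = c k 2 * ξ ^ 2 + c k 1 * ξ + c k 0 := by
    simpa only [not_eventually, not_not] using hcon
  obtain ⟨j, hj⟩ := hfreq.exists
  -- two monic integral cubics with the root `ξ` coincide
  have hconst (k : ℕ) (hk : ξ ^ 3 = c k 2 * ξ ^ 2 + c k 1 * ξ + c k 0) : c k 1 = c j 1 ∧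
      c k 2 = c j 2 := by
    have := eq_zero_of_quadratic_eq_zero hξ (a := c k 0 - c j 0) (b := c k 1 - c j 1)
      (c := c k 2 - c j 2) (by push_cast; linear_combination hj - hk)
    omega
  -- but the derivatives at `ξ` tend to infinity
  have hderiv := hy.one_isLittleO_size.trans_isBigO (h.size_isBigO_deriv hn hy)
  set D := |3 * ξ ^ 2 - (c j 1 + 2 * ξ * c j 2)| with hD
  have hD0 : 0 ≤ D := abs_nonneg _
  obtain ⟨k, hk, hkD⟩ := (hfreq.and_eventually
    (hderiv.bound (show 0 < 1 / (D + 1) by positivity))).exists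
  obtain ⟨h1, h2⟩ := hconst k hk
  rw [h1, h2, norm_one, Real.norm_eq_abs, ← hD, one_div_mul_eq_div,
    le_div_iff₀ (by positivity)] at hkD
  linarith

/-- With `h` the `size`, the root `α` nearest to `ξ` satisfies `|ξ - α| ≪ Y_{k+1} ^ (-γ) / h` and
`H(α) ≪ h ≪ Y_{k+1} ^ (1 - δ)`. Hence `|ξ - α| ≪ h ^ (-1 - γ / (1 - δ))`, and the exponent is `-θ`.
The condition on `δ` makes the term `Y_{k+2} / Y_{k+1}` of `h` at most of order
`Y_{k+1} ^ (1 - δ)`. -/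
theorem CubicFamily.exists_infinite {ξ : ℝ} (hξ : IsExtremal ξ) {Y : ℕ → ℕ} {y : ℕ → Fin 3 → ℤ}
    (hy : IsApproxPair ξ Y y) {n : ℕ} (hn : 0 < n) {c : ℕ → Fin 3 → ℤ} {e₀ e₁ e₂ : ℕ → ℝ}
    (h : CubicFamily ξ y n c e₀ e₁ e₂) {l : Filter ℕ} [l.NeBot] (hl : l ≤ atTop) {δ : ℝ}
    (hδ : δ ≤ 2 - Real.goldenRatio)
    (he : e₁ =O[l] fun k => (Y (k + 1) : ℝ) ^ (-δ)) :
    ∃ c₂ : ℝ, 0 < c₂ ∧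
      {α : ℂ | IsIntegral ℤ α ∧ (minpoly ℤ α).natDegree ≤ 3 ∧
        ‖(ξ : ℂ) - α‖ ≤ c₂ * height α ^
          (-((Real.goldenRatio ^ 2 - δ) / (1 - δ)))}.Infinite := by
  set θ := (Real.goldenRatio ^ 2 - δ) / (1 - δ) with hθ
  have hδ1 : 0 < 1 - δ := by linarith [Real.one_lt_goldenRatio]
  have hθ1 : θ = 1 + Real.goldenRatio / (1 - δ) := by
    rw [hθ, Real.goldenRatio_sq]; field_simp; ring
  have hγ := Real.goldenRatio_pos
  have hθ0 : 0 ≤ θ := by rw [hθ1]; positivity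
  have hroot (k : ℕ) := exists_near_root ξ (c k 0) (c k 1) (c k 2)
    (H := 1 + (|(c k 0 : ℝ)| + |(c k 1 : ℝ)| + |(c k 2 : ℝ)|))
    (le_add_of_nonneg_right (by positivity))
    (by linarith [abs_nonneg (c k 1 : ℝ), abs_nonneg (c k 2 : ℝ)])
    (by linarith [abs_nonneg (c k 0 : ℝ), abs_nonneg (c k 2 : ℝ)])
    (by linarith [abs_nonneg (c k 0 : ℝ), abs_nonneg (c k 1 : ℝ)])
  choose α hα3 hαint hαdeg hαle hαht using hroot
  have hs : Tendsto (size Y e₁) l atTop := (hy.tendsto_size e₁).mono_left hl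
  have hspos : ∀ᶠ k in l, 0 < size Y e₁ k := hs.eventually_gt_atTop 0
  have hs0 : ∀ᶠ k in l, 0 ≤ size Y e₁ k := hspos.mono fun _ hk => hk.le
  -- the height of `α_k` is at most of the order of `size`
  have hheight : (fun k => height (α k)) =O[l] size Y e₁ := by
    have h1 : (fun k => 1 + (|(c k 0 : ℝ)| + |(c k 1 : ℝ)| + |(c k 2 : ℝ)|)) =O[l] size Y e₁ :=
      (hy.one_isLittleO_size.isBigO.add (((h.coeff_isBigO hy 0).abs_left.add
        (h.coeff_isBigO hy 1).abs_left).add (h.coeff_isBigO hy 2).abs_left)).mono hl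
    refine IsBigO.trans (IsBigO.of_norm_le fun k => ?_) (h1.const_mul_left 6)
    rw [Real.norm_of_nonneg (zero_le_one.trans (one_le_height (hαint k)))]
    exact hαht k
  have hheightpow : (fun k => size Y e₁ k ^ (-θ)) =O[l] fun k => height (α k) ^ (-θ) := by
    have h1 := (hheight.rpow hθ0 hs0).inv_rev ?_
    · refine h1.congr' ?_ ?_
      · filter_upwards [hs0] with k hk using (Real.rpow_neg hk _).symm
      · exact Eventually.of_forall fun k =>
          (Real.rpow_neg (zero_le_one.trans (one_le_height (hαint k))) _).symm
    · refine Eventually.of_forall fun k h0 => absurd h0 ?_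
      exact (Real.rpow_pos_of_pos (zero_lt_one.trans_le (one_le_height (hαint k))) _).ne'
  -- distance from `ξ` to `α_k`
  have hdist : (fun k => ‖(ξ : ℂ) - α k‖) =O[l]
      fun k => (Y (k + 2) : ℝ)⁻¹ * (size Y e₁ k)⁻¹ := by
    have h1 := (h.size_isBigO_deriv hn hy).mono hl
    have h2 := h1.inv_rev (hspos.mono fun k hk h0 => absurd h0 hk.ne')
    have h3 : (fun k => ‖(ξ : ℂ) - α k‖ * |3 * ξ ^ 2 - (c k 1 + 2 * ξ * c k 2)|) =O[l]
        fun k => (Y (k + 2) : ℝ)⁻¹ := by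
      refine IsBigO.trans (IsBigO.of_norm_le fun k => ?_)
        (((h.eval_isBigO hy).mono hl).abs_left.const_mul_left 3)
      rw [Real.norm_of_nonneg (by positivity)]
      exact hαle k
    refine (h3.mul h2.abs_left).congr' ?_ .rfl
    filter_upwards [h1.eq_zero_imp, hspos] with k hk hk'
    have hne : 3 * ξ ^ 2 - (c k 1 + 2 * ξ * c k 2) ≠ 0 := fun h0 => hk'.ne' (hk h0)
    rw [abs_inv, mul_assoc, mul_inv_cancel₀ (abs_ne_zero.2 hne), mul_one]
  have hsize : size Y e₁ =O[l] fun k => (Y (k + 1) : ℝ) ^ (1 - δ) := by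
    have h1 := ((hy.two_one_isTheta.1.trans (hy.rpow_isBigO
      (show Real.goldenRatio - 1 ≤ 1 - δ by linarith)))).mono hl
    have h2 := he.abs_left.mul (hy.two_zero_isTheta.1.mono hl)
    refine h1.add (h2.trans_eventuallyEq ?_)
    filter_upwards [hl (hy.eventually_pos 1)] with k hk
    rw [sub_eq_neg_add, Real.rpow_add hk, Real.rpow_one]
  have hYsize : (fun k => (Y (k + 2) : ℝ)⁻¹) =O[l]
      fun k => size Y e₁ k ^ (-(Real.goldenRatio / (1 - δ))) := by
    have h1 := hsize.rpow (r := Real.goldenRatio / (1 - δ)) (by positivity)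
      (Eventually.of_forall fun k => by positivity)
    have h2 : (fun k => size Y e₁ k ^ (Real.goldenRatio / (1 - δ))) =O[l]
        fun k => (Y (k + 2) : ℝ) := by
      refine (h1.trans_eventuallyEq ?_).trans (hy.two_isTheta.2.mono hl)
      filter_upwards [hl (hy.eventually_pos 1)] with k hk
      rw [← Real.rpow_mul hk.le]
      congr 1
      field_simp
    refine (h2.inv_rev ?_).congr' .rfl ?_
    · exact hspos.mono fun k hk h0 => absurd h0 (Real.rpow_pos_of_pos hk _).ne'
    · filter_upwards [hs0] with k hk using (Real.rpow_neg hk _).symm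
  have hfinal : (fun k => ‖(ξ : ℂ) - α k‖) =O[l] fun k => height (α k) ^ (-θ) := by
    refine ((hdist.trans (hYsize.mul (isBigO_refl _ _))).trans_eventuallyEq ?_).trans hheightpow
    filter_upwards [hspos] with k hk
    rw [← Real.rpow_neg_one, ← Real.rpow_add hk, hθ1]
    congr 1
    ring
  have hlim : Tendsto α l (𝓝 (ξ : ℂ)) := by
    rw [tendsto_iff_norm_sub_tendsto_zero]
    have h1 : Tendsto (fun k => (Y (k + 2) : ℝ)⁻¹ * (size Y e₁ k)⁻¹) l (𝓝 0) := by
      have h2 : Tendsto (fun k => (Y (k + 2) : ℝ)⁻¹) l (𝓝 0) :=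
        (tendsto_inv_atTop_zero.comp ((tendsto_add_atTop_iff_nat 2).2 hy.tendsto)).mono_left hl
      simpa using h2.mul (tendsto_inv_atTop_zero.comp hs)
    refine (hdist.trans_tendsto h1).congr fun k => norm_sub_rev _ _
  have hne : ∀ᶠ k in l, α k ≠ ξ := by
    filter_upwards [hl (h.eventually_ne hξ hy hn)] with k hk h0
    have := hα3 k
    rw [h0] at this
    exact hk (by exact_mod_cast this)
  obtain ⟨C, hC0, hC⟩ := hfinal.exists_pos
  refine ⟨C, hC0, fun hfin => ?_⟩
  set F := {α : ℂ | IsIntegral ℤ α ∧ (minpoly ℤ α).natDegree ≤ 3 ∧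
        ‖(ξ : ℂ) - α‖ ≤ C * height α ^ (-θ)}
  have hmem : ∀ᶠ k in l, α k ∈ F := by
    filter_upwards [hC.bound] with k hk
    refine ⟨hαint k, hαdeg k, ?_⟩
    rwa [norm_norm, Real.norm_of_nonneg (Real.rpow_nonneg
      (zero_le_one.trans (one_le_height (hαint k))) _)] at hk
  -- a finite set of points different from `ξ` stays away from `ξ`
  have haway : ∀ᶠ k in l, α k ∉ F \ {(ξ : ℂ)} :=
    hlim.eventually ((hfin.subset Set.sdiff_subset).isClosed.isOpen_compl.mem_nhds (by simp))
  obtain ⟨k, h1, h2, h3⟩ := (hne.and (hmem.and haway)).exists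
  exact h3 ⟨h2, h1⟩

end CubicApprox

theorem proposition10p1 (ξ : ℝ) (hξ : CubicApprox.IsExtremal ξ)
    (Y : ℕ → ℕ) (y : ℕ → Fin 3 → ℤ) (hy : CubicApprox.IsApproxPair ξ Y y)
    (ℓ : ℕ)
    (hℓ : ℓ = CubicApprox.seqLcm (fun k => CubicApprox.det3 (y k) (y (k + 1)) (y (k + 2))))
    (c₁ δ : ℝ) (hc₁ : 0 < c₁) (hδ : 0 < δ)
    (hinf : {k : ℕ | 1 ≤ k ∧
      CubicApprox.distInt ((y k 0 : ℝ) * ξ ^ 3 / (ℓ : ℝ)) ≤ c₁ * (Y k : ℝ) ^ (-δ)}.Infinite) :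
    ∃ c₂ : ℝ, 0 < c₂ ∧
      {α : ℂ | IsIntegral ℤ α ∧ (minpoly ℤ α).natDegree ≤ 3 ∧
        ‖(ξ : ℂ) - α‖ ≤ c₂ * CubicApprox.height α ^
          (-((Real.goldenRatio ^ 2 - δ) / (1 - δ)))}.Infinite := by
  obtain ⟨hpos, hdvd⟩ := hy.seqLcm_spec
  rw [← hℓ] at hpos hdvd
  let P (k : ℕ) : Prop :=
    CubicApprox.distInt ((y k 0 : ℝ) * ξ ^ 3 / (ℓ : ℝ)) ≤ c₁ * (Y k : ℝ) ^ (-δ)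
  have hfreq : ∃ᶠ k in Filter.atTop, P (k + 1) := by
    have h1 : ∃ᶠ k in Filter.atTop, P k :=
      (Nat.frequently_atTop_iff_infinite.2 hinf).mono fun _ hk => hk.2
    rwa [← Filter.map_add_atTop_eq_nat 1, Filter.frequently_map] at h1
  let l : Filter ℕ := Filter.atTop ⊓ Filter.principal {k | P (k + 1)}
  have hl : l ≤ Filter.atTop := inf_le_left
  have : l.NeBot := Filter.frequently_mem_iff_neBot.1 hfreq
  have he : Asymptotics.IsBigO l (fun k => CubicApprox.nearErr ℓ (y (k + 1) 0 * ξ ^ 3))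
      fun k => (Y (k + 1) : ℝ) ^ (-δ) := by
    refine Asymptotics.IsBigO.of_bound (ℓ * c₁) ?_
    filter_upwards [Filter.mem_inf_of_right (Filter.mem_principal_self _)] with k hk
    rw [Real.norm_eq_abs, CubicApprox.abs_nearErr hpos, Real.norm_of_nonneg (by positivity),
      mul_assoc]
    exact mul_le_mul_of_nonneg_left hk (Nat.cast_nonneg _)
  rcases le_or_gt δ (2 - Real.goldenRatio) with h | h
  · obtain ⟨c, e₀, e₂, hc⟩ := CubicApprox.exists_cubicFamily ξ hpos hdvd
    exact hc.exists_infinite hξ hy hpos hl h he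
  · -- the hypothesis fails for exponents beyond `2 - γ`
    refine absurd ?_ (hy.not_isBigO_rpow hξ.1 hl h
      fun k => ℓ * round ((y (k + 1) 0 : ℝ) * ξ ^ 3 / (ℓ : ℝ)))
    simpa [CubicApprox.nearErr] using he
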